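/- Let $\mathbb{F}$ be a field of characteristic $0$. A \emph{graded artinian $\mathbb{F}$-algebra} is a commutative ring $A=\bigoplus_{i\ge 0}A_i$, graded by $\mathbb{N}$, which is a nonzero $\mathbb{F}$-algebra with $A_0=\mathbb{F}$ and $\dim_{\mathbb{F}}A<\infty$ (it need not be generated in degree one). Its \emph{maximal socle degree} is the largest integer $c$ with $A_c\neq 0$. An element $L\in A_1$ is a \emph{strong Lefschetz element in the narrow sense} on $A$ if the multiplication maps $\times L^{c-2i}\colon A_i\to A_{c-i}$ are bijections for all integers $0\le i\le \lfloor c/2\rfloor$, where $c$ is the maximal socle degree of $A$; $A$ has the \emph{strong Lefschetz property in the narrow sense} (SLPn) if such an $L$ exists. Let $A$ and $A'$ be graded artinian $\mathbb{F}$-algebras, and grade $A\otimes_{\mathbb{F}}A'$ by $(A\otimes_{\mathbb{F}}A')_k=\bigoplus_{i+j=k}A_i\otimes_{\mathbb{F}}A'_j$. Then $A\otimes_{\mathbb{F}}A'$ is a graded artinian $\mathbb{F}$-algebra, and: 1. If $\mathbb{F}$ is algebraically closed, $L$ is a strong Lefschetz element in the narrow sense on $A$, and $L'$ is a strong Lefschetz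 element in the narrow sense on $A'$, then $L\otimes 1+1\otimes L'$ is a strong Lefschetz element in the narrow sense on $A\otimes_{\mathbb{F}}A'$. 2. If $A$ and $A'$ satisfy SLPn (with $\mathbb{F}$ not necessarily algebraically closed), then $A\otimes_{\mathbb{F}}A'$ satisfies SLPn. -/

import Mathlib

open scoped TensorProduct DirectSum

section GradedArtinian

variable {F A : Type*} [Field F] [CommRing A] [Algebra F A]

/-- A commutative `ℕ`-graded algebra `A = ⨁ 𝒜 i` over a field `F` is a graded artinian `F`-algebra
if its degree zero component is (the nonzero copy of) the field `F` and it is finite dimensional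
over `F`. No hypothesis is made on the degrees of the generators. -/
structure IsGradedArtinianAlgebra (𝒜 : ℕ → Submodule F A) [GradedAlgebra 𝒜] : Prop where
  nontrivial : Nontrivial A
  mem_zero_iff : ∀ a : A, a ∈ 𝒜 0 ↔ ∃ r : F, algebraMap F A r = a
  finite : Module.Finite F A

/-- `c` is the maximal socle degree of `A = ⨁ 𝒜 i`: the largest `c` with `𝒜 c ≠ 0`. -/
def IsMaximalSocleDegree (𝒜 : ℕ → Submodule F A) (c : ℕ) : Prop :=
  IsGreatest {i : ℕ | 𝒜 i ≠ ⊥} c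

/-- `L` is a strong Lefschetz element in the narrow sense on `A = ⨁ 𝒜 i`: it is homogeneous of
degree one and, for `c` the maximal socle degree of `A`, the multiplication maps
`L ^ (c - 2 * i) : 𝒜 i → 𝒜 (c - i)` are bijections for all `0 ≤ i ≤ c / 2`. -/
def IsNarrowStrongLefschetzElement (𝒜 : ℕ → Submodule F A) [GradedAlgebra 𝒜] (L : A) : Prop :=
  L ∈ 𝒜 1 ∧ ∃ c : ℕ, IsMaximalSocleDegree 𝒜 c ∧
    ∀ i : ℕ, 2 * i ≤ c →
      Set.BijOn (fun x : A => L ^ (c - 2 * i) * x) (𝒜 i : Set A) (𝒜 (c - i) : Set A)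

/-- The strong Lefschetz property in the narrow sense (SLPn). -/
def HasNarrowStrongLefschetzProperty (𝒜 : ℕ → Submodule F A) [GradedAlgebra 𝒜] : Prop :=
  ∃ L : A, IsNarrowStrongLefschetzElement 𝒜 L

end GradedArtinian

section TensorGrading

variable {F A B : Type*} [Field F] [CommRing A] [Algebra F A] [CommRing B] [Algebra F B]

/-- The total grading on `A ⊗ B`: its degree `k` component is the sum of the (images of the)
`𝒜 i ⊗ ℬ j` over all `i + j = k`. -/
def tensorGrading (𝒜 : ℕ → Submodule F A) (ℬ : ℕ → Submodule F B) (k : ℕ) :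
    Submodule F (A ⊗[F] B) :=
  ⨆ (p : ℕ × ℕ) (_ : p.1 + p.2 = k),
    LinearMap.range (TensorProduct.mapIncl (𝒜 p.1) (ℬ p.2))

theorem range_mapIncl_le_tensorGrading (𝒜 : ℕ → Submodule F A) (ℬ : ℕ → Submodule F B)
    (p : ℕ × ℕ) :
    LinearMap.range (TensorProduct.mapIncl (𝒜 p.1) (ℬ p.2)) ≤
      tensorGrading 𝒜 ℬ (p.1 + p.2) :=
  le_iSup₂_of_le (f := fun (q : ℕ × ℕ) (_ : q.1 + q.2 = p.1 + p.2) =>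
    LinearMap.range (TensorProduct.mapIncl (𝒜 q.1) (ℬ q.2))) p rfl le_rfl

theorem tmul_mem_tensorGrading (𝒜 : ℕ → Submodule F A) (ℬ : ℕ → Submodule F B)
    {i j : ℕ} {a : A} {b : B} (ha : a ∈ 𝒜 i) (hb : b ∈ ℬ j) :
    a ⊗ₜ[F] b ∈ tensorGrading 𝒜 ℬ (i + j) :=
  range_mapIncl_le_tensorGrading 𝒜 ℬ (i, j) ⟨(⟨a, ha⟩ : 𝒜 i) ⊗ₜ (⟨b, hb⟩ : ℬ j), rfl⟩

/-- A linear property of elements of `tensorGrading 𝒜 ℬ k` can be checked on products of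
homogeneous elements. -/
theorem tensorGrading_induction (𝒜 : ℕ → Submodule F A) (ℬ : ℕ → Submodule F B) {k : ℕ}
    (N : Submodule F (A ⊗[F] B))
    (h : ∀ i j : ℕ, i + j = k → ∀ a ∈ 𝒜 i, ∀ b ∈ ℬ j, a ⊗ₜ[F] b ∈ N) :
    tensorGrading 𝒜 ℬ k ≤ N := by
  refine iSup₂_le fun p hp => ?_
  rintro _ ⟨x, rfl⟩
  induction x with
  | zero => simp
  | add x y hx hy => rw [map_add]; exact N.add_mem hx hy
  | tmul a b => exact h p.1 p.2 hp a a.2 b b.2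

instance tensorGrading_gradedMonoid (𝒜 : ℕ → Submodule F A) (ℬ : ℕ → Submodule F B)
    [GradedAlgebra 𝒜] [GradedAlgebra ℬ] : SetLike.GradedMonoid (tensorGrading 𝒜 ℬ) where
  one_mem := by
    have h := tmul_mem_tensorGrading 𝒜 ℬ (SetLike.one_mem_graded 𝒜) (SetLike.one_mem_graded ℬ)
    rw [Algebra.TensorProduct.one_def]
    exact h
  mul_mem k l x y hx hy := by
    have key : tensorGrading 𝒜 ℬ k ≤
        (tensorGrading 𝒜 ℬ (k + l)).comap (LinearMap.mulRight F y) := by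
      refine tensorGrading_induction 𝒜 ℬ _ fun i j hij a ha b hb => ?_
      have key2 : tensorGrading 𝒜 ℬ l ≤
          (tensorGrading 𝒜 ℬ (k + l)).comap (LinearMap.mulLeft F (a ⊗ₜ[F] b)) := by
        refine tensorGrading_induction 𝒜 ℬ _ fun i' j' hij' a' ha' b' hb' => ?_
        have := tmul_mem_tensorGrading 𝒜 ℬ (SetLike.mul_mem_graded ha ha')
          (SetLike.mul_mem_graded hb hb')
        have e : i + i' + (j + j') = k + l := by omega
        rw [e] at this
        simpa using this
      exact key2 hy
    exact key hx

/-- The map sending `a ⊗ b`, with `a`, `b` homogeneous of degrees `i`, `j`, to `a ⊗ b` placed in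
degree `i + j`. -/
noncomputable def tensorGradingDecompose (𝒜 : ℕ → Submodule F A) (ℬ : ℕ → Submodule F B)
    [GradedAlgebra 𝒜] [GradedAlgebra ℬ] :
    A ⊗[F] B →ₗ[F] ⨁ k, tensorGrading 𝒜 ℬ k :=
  (DirectSum.toModule F (ℕ × ℕ) _ fun p =>
      DirectSum.lof F ℕ (fun k => tensorGrading 𝒜 ℬ k) (p.1 + p.2) ∘ₗ
        (TensorProduct.mapIncl (𝒜 p.1) (ℬ p.2)).codRestrict _ fun x =>
          range_mapIncl_le_tensorGrading 𝒜 ℬ p ⟨x, rfl⟩) ∘ₗ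
    (TensorProduct.directSum F F (fun i => 𝒜 i) (fun j => ℬ j)).toLinearMap ∘ₗ
    TensorProduct.map (DirectSum.decomposeLinearEquiv 𝒜).toLinearMap
      (DirectSum.decomposeLinearEquiv ℬ).toLinearMap

theorem tensorGradingDecompose_tmul (𝒜 : ℕ → Submodule F A) (ℬ : ℕ → Submodule F B)
    [GradedAlgebra 𝒜] [GradedAlgebra ℬ] {i j : ℕ} {a : A} {b : B} (ha : a ∈ 𝒜 i) (hb : b ∈ ℬ j) :
    tensorGradingDecompose 𝒜 ℬ (a ⊗ₜ b) =
      DirectSum.lof F ℕ (fun k => tensorGrading 𝒜 ℬ k) (i + j)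
        ⟨a ⊗ₜ b, tmul_mem_tensorGrading 𝒜 ℬ ha hb⟩ := by
  simp only [tensorGradingDecompose, LinearMap.comp_apply, TensorProduct.map_tmul,
    LinearEquiv.coe_coe, DirectSum.decomposeLinearEquiv_apply, DirectSum.decompose_of_mem 𝒜 ha,
    DirectSum.decompose_of_mem ℬ hb]
  erw [TensorProduct.directSum_lof_tmul_lof, DirectSum.toModule_lof]
  rfl

noncomputable instance tensorGrading_gradedAlgebra (𝒜 : ℕ → Submodule F A)
    (ℬ : ℕ → Submodule F B) [GradedAlgebra 𝒜] [GradedAlgebra ℬ] :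
    GradedAlgebra (tensorGrading 𝒜 ℬ) where
  toGradedMonoid := tensorGrading_gradedMonoid 𝒜 ℬ
  toDecomposition := by
    refine DirectSum.Decomposition.ofLinearMap _ (tensorGradingDecompose 𝒜 ℬ) ?_ ?_
    · refine TensorProduct.ext' fun a b => ?_
      induction a using DirectSum.Decomposition.inductionOn 𝒜 with
      | zero => simp
      | add x y hx hy => rw [TensorProduct.add_tmul, map_add, hx, hy, map_add]
      | homogeneous a =>
        induction b using DirectSum.Decomposition.inductionOn ℬ with
        | zero => simp
        | add x y hx hy => rw [TensorProduct.tmul_add, map_add, hx, hy, map_add]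
        | homogeneous b =>
          rw [LinearMap.comp_apply, tensorGradingDecompose_tmul 𝒜 ℬ a.2 b.2]
          simp
    · refine DirectSum.linearMap_ext F fun k => LinearMap.ext fun x => ?_
      obtain ⟨x, hx⟩ := x
      have key : ∀ y (hy : y ∈ tensorGrading 𝒜 ℬ k), tensorGradingDecompose 𝒜 ℬ y =
          DirectSum.lof F ℕ (fun k => tensorGrading 𝒜 ℬ k) k ⟨y, hy⟩ := by
        have hle : tensorGrading 𝒜 ℬ k ≤
            (LinearMap.eqLocus
              (tensorGradingDecompose 𝒜 ℬ ∘ₗ (tensorGrading 𝒜 ℬ k).subtype)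
              (DirectSum.lof F ℕ (fun k => tensorGrading 𝒜 ℬ k) k)).map (tensorGrading 𝒜 ℬ k).subtype := by
          refine tensorGrading_induction 𝒜 ℬ _ fun i j hij a ha b hb => ?_
          subst hij
          refine ⟨⟨a ⊗ₜ b, tmul_mem_tensorGrading 𝒜 ℬ ha hb⟩, ?_, rfl⟩
          exact tensorGradingDecompose_tmul 𝒜 ℬ ha hb
        intro y hy
        obtain ⟨z, hz, rfl⟩ := hle hy
        exact hz
      simpa using key x hx

end TensorGrading

/-! Each Lefschetz element splits its algebra into strings `p, L p, L² p, …`, with `p` primitive of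
degree `i` and killed by `L ^ (c - 2 * i + 1)` (`le_span_lefschetzStrings`). For two primitives `p`,
`q`, the elements `x = L ⊗ 1` and `y = 1 ⊗ L'` act on `w = p ⊗ q` with `x ^ (m + 1) * w = 0` and `y
^ (n + 1) * w = 0`, so it suffices that `(x + y) ^ (m + n - 2 * r)` maps degree `r` onto degree `m +
n - r` in `F[x, y] / (x ^ (m + 1), y ^ (n + 1))`. Setting `y = 1` turns this into prescribing a
window of coefficients of `(1 + X) ^ d * g` with `deg g ≤ r`, which is possible in characteristic
zero (`exists_coeff_one_add_X_pow_mul_eq`).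

This gives surjectivity only. Injectivity follows by counting dimensions, since the Hilbert function
of the tensor product inherits the symmetry of its factors (`finrank_tensorGrading_le_finrank_sub`).
-/

/-! ### Coefficient windows of `(1 + X) ^ d * g` -/

open Polynomial in
theorem exists_iterate_derivative_one_add_X_pow_mul {F : Type*} [Field F] {r d a : ℕ}
    (had : a ≤ d) (g : F[X]) (hg : g ∈ degreeLT F (r + 1)) :
    ∃ g' ∈ degreeLT F (r + 1),
      derivative^[a] ((1 + X) ^ d * g) = (1 + X) ^ (d - a) * g' := by
  induction a with
  | zero => exact ⟨g, hg, by simp⟩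
  | succ a ih =>
    obtain ⟨g', hg', h⟩ := ih (by omega)
    obtain ⟨e, he⟩ : ∃ e, d - a = e + 1 := ⟨d - a - 1, by omega⟩
    -- From `((1 + X) ^ (e + 1) * g')' = (1 + X) ^ e * ((e + 1) * g' + (1 + X) * derivative g')`;
    -- the second factor has degree at most that of `g'`.
    refine ⟨((e + 1 : ℕ) : F) • g' + (derivative g' + X * derivative g'), ?_, ?_⟩
    · rw [mem_degreeLT, degree_lt_iff_coeff_zero] at hg' ⊢
      intro j hj
      obtain ⟨j, rfl⟩ : ∃ i, j = i + 1 := ⟨j - 1, by omega⟩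
      simp [coeff_derivative, hg' _ hj, hg' (j + 1 + 1) (by omega)]
    · rw [Function.iterate_succ_apply', h, he, show d - (a + 1) = e by omega]
      simp only [derivative_mul, derivative_pow, derivative_add, derivative_one, derivative_X,
        Polynomial.smul_eq_C_mul]
      simp
      ring

-- Differentiating `a` times moves the vanishing window to the bottom, so `X ^ (r + 1)` divides `(1
-- + X) ^ (d - a) * g'`. It is coprime to the power of `1 + X` and `deg g' ≤ r`, hence `g' = 0`.
open Polynomial in
theorem eq_zero_of_coeff_one_add_X_pow_mul {F : Type*} [Field F] [CharZero F] {r d a : ℕ}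
    (had : a ≤ d) (g : F[X]) (hg : g ∈ degreeLT F (r + 1))
    (h0 : ∀ j ≤ r, ((1 + X) ^ d * g).coeff (j + a) = 0) : g = 0 := by
  obtain ⟨g', hg', h⟩ := exists_iterate_derivative_one_add_X_pow_mul had g hg
  have hdvd : X ^ (r + 1) ∣ derivative^[a] ((1 + X) ^ d * g) := by
    rw [X_pow_dvd_iff]
    intro j hj
    rw [coeff_iterate_derivative, h0 j (by omega), smul_zero]
  have hcop : IsCoprime ((X : F[X]) ^ (r + 1)) ((1 + X) ^ (d - a)) :=
    IsCoprime.pow ⟨-1, 1, by ring⟩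
  rw [h] at hdvd
  have hg0 : g' = 0 := by
    have h1 := hcop.dvd_of_dvd_mul_left hdvd
    refine eq_zero_of_dvd_of_degree_lt h1 ?_
    rw [degree_X_pow]
    exact mem_degreeLT.1 hg'
  rw [hg0, mul_zero] at h
  by_contra hne
  have hmon : (1 + X : F[X]).Monic := by rw [add_comm]; exact monic_X_add_C 1
  have hdeg : ((1 + X) ^ d * g).natDegree = d + g.natDegree := by
    have hn : (1 + X : F[X]).natDegree = 1 := by rw [add_comm]; exact natDegree_X_add_C 1
    rw [(hmon.pow d).natDegree_mul' hne, hmon.natDegree_pow, hn, mul_one]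
  have hlead : ((1 + X) ^ d * g).coeff (d + g.natDegree) ≠ 0 := by
    rw [← hdeg]
    exact leadingCoeff_ne_zero.2 (mul_ne_zero (hmon.pow d).ne_zero hne)
  -- The `a`-th derivative vanishes, but its top coefficient is a falling factorial times a leading
  -- coefficient, nonzero in characteristic zero because `a ≤ d`.
  have hc := congrArg (fun f => coeff f (d + g.natDegree - a)) h
  simp only [coeff_iterate_derivative, coeff_zero,
    show d + g.natDegree - a + a = d + g.natDegree by omega, nsmul_eq_mul] at hc
  rcases mul_eq_zero.1 hc with hc | hc
  · rw [Nat.cast_eq_zero, Nat.descFactorial_eq_zero_iff_lt] at hc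
    omega
  · exact hlead hc

-- The window map is an injective endomorphism up to dimension: both sides have dimension `r + 1`.
open Polynomial in
theorem exists_coeff_one_add_X_pow_mul_eq {F : Type*} [Field F] [CharZero F] {r d a : ℕ}
    (had : a ≤ d) (v : Fin (r + 1) → F) :
    ∃ g ∈ degreeLT F (r + 1), ∀ j : Fin (r + 1), ((1 + X) ^ d * g).coeff (j + a) = v j := by
  let φ : degreeLT F (r + 1) →ₗ[F] (Fin (r + 1) → F) :=
    LinearMap.pi fun j => lcoeff F (j + a) ∘ₗ LinearMap.mulLeft F ((1 + X) ^ d) ∘ₗ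
      (degreeLT F (r + 1)).subtype
  have hφ : Function.Injective φ := by
    rw [injective_iff_map_eq_zero]
    rintro ⟨g, hg⟩ h
    refine Subtype.ext (eq_zero_of_coeff_one_add_X_pow_mul had g hg fun j hj => ?_)
    exact congrFun h ⟨j, by omega⟩
  have : Module.Finite F (degreeLT F (r + 1)) :=
    Module.Finite.equiv (degreeLTEquiv F (r + 1)).symm
  have hs := (LinearMap.injective_iff_surjective_of_finrank_eq_finrank
    (degreeLTEquiv F (r + 1)).finrank_eq).1 hφ
  obtain ⟨⟨g, hg⟩, h⟩ := hs v
  exact ⟨g, hg, fun j => congrFun h j⟩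

/-! ### Surjectivity for a pair of nilpotent variables -/

section Monomials

variable {F R : Type*} [Field F] [CommRing R] [Algebra F R]

/-- The span of the products `x ^ i * y ^ j * w` with `i + j = r`. -/
def monomialSpan (F : Type*) {R : Type*} [Field F] [CommRing R] [Algebra F R]
    (x y w : R) (r : ℕ) : Submodule F R :=
  Submodule.span F {z | ∃ i j, i + j = r ∧ z = x ^ i * y ^ j * w}

theorem monomialSpan_swap (x y w : R) (r : ℕ) :
    monomialSpan F y x w r = monomialSpan F x y w r := by
  unfold monomialSpan
  congr 1
  ext z
  constructor <;>
  · rintro ⟨i, j, h, rfl⟩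
    exact ⟨j, i, by omega, by ring⟩

theorem monomialSpan_pow_mul_le (x y w : R) (r k : ℕ) :
    monomialSpan F x y (y ^ k * w) r ≤ monomialSpan F x y w (r + k) := by
  refine Submodule.span_le.2 ?_
  rintro _ ⟨i, j, h, rfl⟩
  exact Submodule.subset_span ⟨i, j + k, by omega, by ring⟩

open Polynomial in
theorem sum_coeff_one_add_X_mul (x y : R) (N : ℕ) (q : F[X]) (hq : q.coeff (N + 1) = 0) :
    ∑ l ∈ Finset.range (N + 1 + 1), ((1 + X) * q).coeff l • (x ^ l * y ^ (N + 1 - l)) =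
      (x + y) * ∑ l ∈ Finset.range (N + 1), q.coeff l • (x ^ l * y ^ (N - l)) := by
  have h1 : ∑ l ∈ Finset.range (N + 1 + 1), q.coeff l • (x ^ l * y ^ (N + 1 - l)) =
      y * ∑ l ∈ Finset.range (N + 1), q.coeff l • (x ^ l * y ^ (N - l)) := by
    -- Without `hq` the top term `x ^ (N + 1)` would survive and would not be a multiple of `y`.
    rw [Finset.sum_range_succ, hq, zero_smul, add_zero, Finset.mul_sum]
    refine Finset.sum_congr rfl fun l hl => ?_
    rw [Finset.mem_range] at hl
    rw [show N + 1 - l = N - l + 1 by omega, pow_succ, mul_smul_comm]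
    congr 1
    ring
  have h2 : ∑ l ∈ Finset.range (N + 1 + 1), (X * q).coeff l • (x ^ l * y ^ (N + 1 - l)) =
      x * ∑ l ∈ Finset.range (N + 1), q.coeff l • (x ^ l * y ^ (N - l)) := by
    rw [Finset.sum_range_succ', coeff_X_mul_zero, zero_smul, add_zero, Finset.mul_sum]
    refine Finset.sum_congr rfl fun l hl => ?_
    rw [coeff_X_mul, Nat.add_sub_add_right, pow_succ, mul_smul_comm]
    congr 1
    ring
  rw [add_mul, one_mul]
  simp only [coeff_add, add_smul, Finset.sum_add_distrib]
  rw [h1, h2]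
  ring

open Polynomial in
theorem sum_coeff_one_add_X_pow_mul (x y : R) (r d : ℕ) (g : F[X]) (hg : g ∈ degreeLT F (r + 1)) :
    ∑ l ∈ Finset.range (d + r + 1), ((1 + X) ^ d * g).coeff l • (x ^ l * y ^ (d + r - l)) =
      (x + y) ^ d * ∑ l ∈ Finset.range (r + 1), g.coeff l • (x ^ l * y ^ (r - l)) := by
  induction d with
  | zero => simp
  | succ d ih =>
    have hdeg : ((1 + X) ^ d * g).coeff (d + r + 1) = 0 := by
      refine coeff_eq_zero_of_natDegree_lt ?_
      have h1 : (1 + X : F[X]).natDegree ≤ 1 := by compute_degree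
      have h2 : g.natDegree ≤ r := by
        refine natDegree_le_iff_coeff_eq_zero.2 fun j hj => ?_
        rw [mem_degreeLT, degree_lt_iff_coeff_zero] at hg
        exact hg j hj
      have h3 := natDegree_mul_le (p := (1 + X) ^ d) (q := g)
      have h4 := natDegree_pow_le_of_le d h1
      omega
    rw [pow_succ' (1 + X), mul_assoc, show d + 1 + r = d + r + 1 by omega,
      sum_coeff_one_add_X_mul x y _ _ hdeg, ih, pow_succ']
    ring

/-- Of the monomials in `(x + y) ^ d * g`, those with `x`-exponent above `m` or below `m - r` kill
`w`. The remaining `r + 1` exponents form exactly the window where coefficients are free, so one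
monomial can be isolated. -/
theorem pow_mul_pow_mul_mem_map_monomialSpan_of_le [CharZero F] (x y w : R) {m r d s t : ℕ}
    (hrm : r ≤ m) (hmd : m ≤ d + r) (hx : x ^ (m + 1) * w = 0)
    (hy : ∀ k, d + 2 * r < m + k → k ≤ d + r → y ^ k * w = 0)
    (hs : s ≤ m) (hms : m ≤ s + r) (hst : s + t = d + r) :
    x ^ s * y ^ t * w ∈ (monomialSpan F x y w r).map (LinearMap.mulLeft F ((x + y) ^ d)) := by
  classical
  obtain ⟨g, hg, hgc⟩ := exists_coeff_one_add_X_pow_mul_eq (F := F) (r := r) (d := d) (a := m - r)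
    (by omega) (Pi.single ⟨s - (m - r), by omega⟩ 1)
  refine ⟨(∑ l ∈ Finset.range (r + 1), g.coeff l • (x ^ l * y ^ (r - l))) * w, ?_, ?_⟩
  · rw [Finset.sum_mul]
    refine Submodule.sum_mem _ fun l hl => ?_
    rw [smul_mul_assoc]
    rw [Finset.mem_range] at hl
    exact Submodule.smul_mem _ _ (Submodule.subset_span ⟨l, r - l, by omega, rfl⟩)
  · rw [LinearMap.mulLeft_apply, ← mul_assoc, ← sum_coeff_one_add_X_pow_mul x y r d g hg,
      Finset.sum_mul, Finset.sum_eq_single s]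
    · have := hgc ⟨s - (m - r), by omega⟩
      rw [Pi.single_eq_same, show s - (m - r) + (m - r) = s by omega] at this
      rw [this, one_smul, show d + r - s = t by omega]
    · intro l hl hls
      rw [Finset.mem_range] at hl
      rw [smul_mul_assoc]
      by_cases h1 : m < l
      · rw [show l = (l - (m + 1)) + (m + 1) by omega, pow_add, mul_right_comm, mul_assoc _ _ w, hx,
          mul_zero, zero_mul, smul_zero]
      by_cases h2 : l + r < m
      · rw [mul_assoc, hy _ (by omega) (by omega), mul_zero, smul_zero]
      have := hgc ⟨l - (m - r), by omega⟩
      rw [Pi.single_eq_of_ne (by simp only [ne_eq, Fin.mk.injEq]; omega),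
        show l - (m - r) + (m - r) = l by omega] at this
      rw [this, zero_smul]
    · intro h
      rw [Finset.mem_range] at h
      omega

theorem pow_mul_pow_mul_mem_map_monomialSpan [CharZero F] (x y w : R) {m n r s t : ℕ}
    (hx : x ^ (m + 1) * w = 0) (hy : y ^ (n + 1) * w = 0)
    (hr : 2 * r ≤ m + n) (hst : s + t + r = m + n) :
    x ^ s * y ^ t * w ∈
      (monomialSpan F x y w r).map (LinearMap.mulLeft F ((x + y) ^ (m + n - 2 * r))) := by
  have hx' : ∀ k, m < k → x ^ k * w = 0 := fun k hk => by
    rw [show k = (k - (m + 1)) + (m + 1) by omega, pow_add, mul_assoc, hx, mul_zero]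
  have hy' : ∀ k, n < k → y ^ k * w = 0 := fun k hk => by
    rw [show k = (k - (n + 1)) + (n + 1) by omega, pow_add, mul_assoc, hy, mul_zero]
  by_cases hs : m < s
  · rw [mul_right_comm, hx' s hs, zero_mul]; exact zero_mem _
  by_cases ht : n < t
  · rw [mul_assoc, hy' t ht, mul_zero]; exact zero_mem _
  by_cases hrm : m < r
  · obtain ⟨k, rfl⟩ : ∃ k, r = m + k := ⟨r - m, by omega⟩
    have h := pow_mul_pow_mul_mem_map_monomialSpan_of_le (F := F) x y (y ^ k * w) (m := m) (r := m)
      (d := m + n - 2 * (m + k)) (s := s) (t := t - k) le_rfl (by omega)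
      (by rw [mul_left_comm, hx, mul_zero]) (fun j _ _ => by omega) (by omega) (by omega) (by omega)
    have e : x ^ s * y ^ (t - k) * (y ^ k * w) = x ^ s * y ^ t * w := by
      rw [show t = (t - k) + k by omega, pow_add]; simp; ring
    rw [e] at h
    exact Submodule.map_mono (monomialSpan_pow_mul_le x y w m k) h
  by_cases hrn : n < r
  · obtain ⟨k, rfl⟩ : ∃ k, r = n + k := ⟨r - n, by omega⟩
    have h := pow_mul_pow_mul_mem_map_monomialSpan_of_le (F := F) y x (x ^ k * w) (m := n) (r := n)
      (d := m + n - 2 * (n + k)) (s := t) (t := s - k) le_rfl (by omega)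
      (by rw [mul_left_comm, hy, mul_zero]) (fun j _ _ => by omega) (by omega) (by omega) (by omega)
    have e : y ^ t * x ^ (s - k) * (x ^ k * w) = x ^ s * y ^ t * w := by
      rw [show s = (s - k) + k by omega, pow_add]; simp; ring
    rw [e, add_comm y x] at h
    have h2 := Submodule.map_mono (monomialSpan_pow_mul_le y x w n k) h
    rwa [monomialSpan_swap] at h2
  · exact pow_mul_pow_mul_mem_map_monomialSpan_of_le x y w (by omega) (by omega) hx
      (fun k hk _ => hy' k (by omega)) (by omega) (by omega) (by omega)

end Monomials

/-! ### Primitive decomposition and symmetry of the Hilbert function -/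

section Strings

variable {F A : Type*} [Field F] [CommRing A] [Algebra F A]

/-- The elements `L ^ s * p` of degree `u`, with `p` primitive for `L` of degree `i ≤ c / 2`. -/
def lefschetzStrings (𝒜 : ℕ → Submodule F A) (L : A) (c u : ℕ) : Set A :=
  {z | ∃ i s p, 2 * i ≤ c ∧ i + s = u ∧ p ∈ 𝒜 i ∧ L ^ (c - 2 * i + 1) * p = 0 ∧ z = L ^ s * p}

theorem pow_mul_mem_span_lefschetzStrings (𝒜 : ℕ → Submodule F A) (L : A) (c u k : ℕ) {a : A}
    (ha : a ∈ Submodule.span F (lefschetzStrings 𝒜 L c u)) :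
    L ^ k * a ∈ Submodule.span F (lefschetzStrings 𝒜 L c (u + k)) := by
  have : Submodule.span F (lefschetzStrings 𝒜 L c u) ≤
      (Submodule.span F (lefschetzStrings 𝒜 L c (u + k))).comap (LinearMap.mulLeft F (L ^ k)) := by
    refine Submodule.span_le.2 ?_
    rintro _ ⟨i, s, p, hi, rfl, hp, h0, rfl⟩
    exact Submodule.subset_span ⟨i, s + k, p, hi, by omega, hp, h0, by
      rw [LinearMap.mulLeft_apply]; ring⟩
  exact this ha

variable {𝒜 : ℕ → Submodule F A} {L : A} {c : ℕ}

theorem eq_zero_of_isMaximalSocleDegree_lt (hc : IsMaximalSocleDegree 𝒜 c) {i : ℕ} (hi : c < i)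
    {a : A} (ha : a ∈ 𝒜 i) : a = 0 := by
  by_contra h
  have : i ≤ c := hc.2 fun h' => h (by simpa [h'] using ha)
  omega

theorem finrank_eq_finrank_sub
    (h : ∀ i : ℕ, 2 * i ≤ c →
      Set.BijOn (fun x : A => L ^ (c - 2 * i) * x) (𝒜 i : Set A) (𝒜 (c - i) : Set A))
    {i : ℕ} (hi : i ≤ c) : Module.finrank F (𝒜 i) = Module.finrank F (𝒜 (c - i)) := by
  have low : ∀ i, 2 * i ≤ c → Module.finrank F (𝒜 i) = Module.finrank F (𝒜 (c - i)) := by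
    intro i hi
    let f : 𝒜 i →ₗ[F] 𝒜 (c - i) :=
      (LinearMap.mulLeft F (L ^ (c - 2 * i))).restrict fun x hx => (h i hi).mapsTo hx
    refine (LinearEquiv.ofBijective f ⟨fun x y hxy => ?_, fun y => ?_⟩).finrank_eq
    · exact Subtype.ext ((h i hi).injOn x.2 y.2 (congrArg Subtype.val hxy))
    · obtain ⟨x, hx, hxy⟩ := (h i hi).surjOn y.2
      exact ⟨⟨x, hx⟩, Subtype.ext hxy⟩
  by_cases hi2 : 2 * i ≤ c
  · exact low i hi2
  · have := low (c - i) (by omega)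
    rw [show c - (c - i) = i by omega] at this
    exact this.symm

variable [GradedAlgebra 𝒜]

theorem pow_mul_mem_graded (hL : L ∈ 𝒜 1) (s : ℕ) {i j : ℕ} {p : A} (hp : p ∈ 𝒜 i)
    (h : i + s = j) : L ^ s * p ∈ 𝒜 j := by
  have := SetLike.mul_mem_graded (SetLike.pow_mem_graded s hL) hp
  rwa [smul_eq_mul, mul_one, add_comm, h] at this

theorem le_span_lefschetzStrings (hL : L ∈ 𝒜 1) (hc : IsMaximalSocleDegree 𝒜 c)
    (h : ∀ i : ℕ, 2 * i ≤ c →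
      Set.BijOn (fun x : A => L ^ (c - 2 * i) * x) (𝒜 i : Set A) (𝒜 (c - i) : Set A)) (u : ℕ) :
    𝒜 u ≤ Submodule.span F (lefschetzStrings 𝒜 L c u) := by
  have low : ∀ u, 2 * u ≤ c → 𝒜 u ≤ Submodule.span F (lefschetzStrings 𝒜 L c u) := by
    intro u
    induction u with
    | zero =>
      intro hu a ha
      exact Submodule.subset_span ⟨0, 0, a, hu, rfl, ha,
        eq_zero_of_isMaximalSocleDegree_lt hc (by omega)
          (pow_mul_mem_graded hL _ ha rfl), by simp⟩
    | succ u ih =>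
      intro hu a ha
      have h1 := pow_mul_mem_graded hL (c - 2 * (u + 1) + 1) ha (j := c - u) (by omega)
      -- Bijectivity from degree `u` provides `b` with `L ^ (c - 2 * u) * b = L ^ (c - 2 * u - 1) *
      -- a`; thus `a - L * b` is primitive, and `b` is covered by induction.
      obtain ⟨b, hb, hba⟩ := (h u (by omega)).surjOn h1
      have hLb := pow_mul_mem_graded hL 1 hb rfl
      have h2 : a - L ^ 1 * b ∈ Submodule.span F (lefschetzStrings 𝒜 L c (u + 1)) := by
        refine Submodule.subset_span ⟨u + 1, 0, _, hu, rfl, sub_mem ha hLb, ?_, by simp⟩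
        rw [mul_sub, ← hba, ← mul_assoc, ← pow_add,
          show c - 2 * (u + 1) + 1 + 1 = c - 2 * u by omega, sub_self]
      have h3 := pow_mul_mem_span_lefschetzStrings 𝒜 L c u 1 (ih (by omega) hb)
      simpa using add_mem h2 h3
  intro a ha
  by_cases hu : 2 * u ≤ c
  · exact low u hu ha
  by_cases huc : c < u
  · rw [eq_zero_of_isMaximalSocleDegree_lt hc huc ha]; exact zero_mem _
  · have ha' : a ∈ 𝒜 (c - (c - u)) := by rwa [show c - (c - u) = u by omega]
    obtain ⟨b, hb, rfl⟩ := (h (c - u) (by omega)).surjOn ha'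
    have := pow_mul_mem_span_lefschetzStrings 𝒜 L c _ (c - 2 * (c - u)) (low _ (by omega) hb)
    rwa [show c - u + (c - 2 * (c - u)) = u by omega] at this

/-- A graded space with symmetric Hilbert function has an automorphism exchanging the degrees `i`
and `c - i`. -/
theorem exists_injective_degree_reversing [Module.Finite F A] (hc : IsMaximalSocleDegree 𝒜 c)
    (h : ∀ i ≤ c, Module.finrank F (𝒜 i) = Module.finrank F (𝒜 (c - i))) :
    ∃ σ : A →ₗ[F] A, Function.Injective σ ∧ ∀ i ≤ c, ∀ a ∈ 𝒜 i, σ a ∈ 𝒜 (c - i) := by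
  classical
  have e : ∀ i ≤ c, Nonempty (𝒜 i ≃ₗ[F] 𝒜 (c - i)) := fun i hi =>
    FiniteDimensional.nonempty_linearEquiv_of_finrank_eq (h i hi)
  let φ : ∀ i, 𝒜 i →ₗ[F] A := fun i =>
    -- The value `0` is harmless: components above `c` vanish.
    if hi : i ≤ c then (𝒜 (c - i)).subtype ∘ₗ ((e i hi).some : 𝒜 i →ₗ[F] 𝒜 (c - i)) else 0
  let σ : A →ₗ[F] A := DirectSum.toModule F ℕ A φ ∘ₗ (DirectSum.decomposeLinearEquiv 𝒜).toLinearMap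
  have hσ : ∀ i (hi : i ≤ c) (a : 𝒜 i), σ a = (e i hi).some a := by
    intro i hi a
    have : σ a = φ i a := by
      simp only [σ, LinearMap.comp_apply, LinearEquiv.coe_coe,
        DirectSum.decomposeLinearEquiv_apply, DirectSum.decompose_coe]
      exact DirectSum.toModule_lof (M := fun i => 𝒜 i) (φ := φ) F i a
    rw [this]
    simp [φ, hi]
  refine ⟨σ, ?_, fun i hi a ha => ?_⟩
  · rw [LinearMap.injective_iff_surjective]
    rw [← LinearMap.range_eq_top, eq_top_iff]
    intro a _
    induction a using DirectSum.Decomposition.inductionOn 𝒜 with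
    | zero => exact zero_mem _
    | add x y hx hy => exact add_mem (hx trivial) (hy trivial)
    | @homogeneous j a =>
      by_cases hj : j ≤ c
      · have ha : (a : A) ∈ 𝒜 (c - (c - j)) := by
          rw [show c - (c - j) = j by omega]; exact a.2
        refine ⟨(e (c - j) (by omega)).some.symm ⟨a, ha⟩, ?_⟩
        rw [hσ (c - j) (by omega), LinearEquiv.apply_symm_apply]
      · rw [eq_zero_of_isMaximalSocleDegree_lt hc (by omega) a.2]; exact zero_mem _
  · have := hσ i hi ⟨a, ha⟩
    rw [this]
    exact SetLike.coe_mem _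

end Strings

theorem bijOn_of_le_map_of_finrank_le {F V : Type*} [Field F] [AddCommGroup V] [Module F V]
    [Module.Finite F V] {p q : Submodule F V} (f : V →ₗ[F] V) (hf : ∀ x ∈ p, f x ∈ q)
    (hq : q ≤ p.map f) (h : Module.finrank F p ≤ Module.finrank F q) :
    Set.BijOn f (p : Set V) (q : Set V) := by
  have hs : Function.Surjective (f.restrict hf) := by
    rintro ⟨y, hy⟩
    obtain ⟨x, hx, hxy⟩ := hq hy
    exact ⟨⟨x, hx⟩, Subtype.ext hxy⟩
  have hi := (LinearMap.injective_iff_surjective_of_finrank_eq_finrank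
    (le_antisymm h (LinearMap.finrank_le_finrank_of_surjective hs))).2 hs
  refine ⟨hf, fun x hx y hy hxy => ?_, hq⟩
  exact congrArg Subtype.val (@hi ⟨x, hx⟩ ⟨y, hy⟩ (Subtype.ext hxy))

/-! ### Transfer to the tensor product -/

section Tensor

variable {F A B : Type*} [Field F] [CommRing A] [Algebra F A] [CommRing B] [Algebra F B]
  {𝒜 : ℕ → Submodule F A} {ℬ : ℕ → Submodule F B}

theorem isMaximalSocleDegree_tensorGrading {c d : ℕ} (hc : IsMaximalSocleDegree 𝒜 c)
    (hd : IsMaximalSocleDegree ℬ d) : IsMaximalSocleDegree (tensorGrading 𝒜 ℬ) (c + d) := by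
  refine ⟨?_, fun k hk => ?_⟩
  · obtain ⟨a, ha, ha0⟩ := Submodule.exists_mem_ne_zero_of_ne_bot hc.1
    obtain ⟨b, hb, hb0⟩ := Submodule.exists_mem_ne_zero_of_ne_bot hd.1
    intro h
    have hm := tmul_mem_tensorGrading 𝒜 ℬ ha hb
    rw [h, Submodule.mem_bot] at hm
    obtain ⟨f, hf⟩ := not_forall.1 (mt (Module.forall_dual_apply_eq_zero_iff F a).1 ha0)
    obtain ⟨g, hg⟩ := not_forall.1 (mt (Module.forall_dual_apply_eq_zero_iff F b).1 hb0)
    have h1 := congrArg (fun z => TensorProduct.lid F F (TensorProduct.map f g z)) hm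
    exact mul_ne_zero hf hg (by simpa using h1)
  · by_contra hlt
    refine hk (eq_bot_iff.2 (tensorGrading_induction 𝒜 ℬ _ fun i j hij a ha b hb => ?_))
    by_cases hi : c < i
    · rw [eq_zero_of_isMaximalSocleDegree_lt hc hi ha, TensorProduct.zero_tmul]
      exact zero_mem _
    · rw [eq_zero_of_isMaximalSocleDegree_lt hd (by omega) hb, TensorProduct.tmul_zero]
      exact zero_mem _

variable [GradedAlgebra 𝒜] [GradedAlgebra ℬ]

theorem isGradedArtinianAlgebra_tensorGrading (hA : IsGradedArtinianAlgebra 𝒜)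
    (hB : IsGradedArtinianAlgebra ℬ) : IsGradedArtinianAlgebra (tensorGrading 𝒜 ℬ) := by
  have := hA.nontrivial
  have := hB.nontrivial
  have := hA.finite
  have := hB.finite
  refine ⟨inferInstance, fun z => ⟨fun hz => ?_, ?_⟩, inferInstance⟩
  · have key : tensorGrading 𝒜 ℬ 0 ≤ LinearMap.range (Algebra.linearMap F (A ⊗[F] B)) := by
      refine tensorGrading_induction 𝒜 ℬ _ fun i j hij a ha b hb => ?_
      obtain rfl : i = 0 := by omega
      obtain rfl : j = 0 := by omega
      obtain ⟨r, rfl⟩ := (hA.mem_zero_iff a).1 ha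
      obtain ⟨s, rfl⟩ := (hB.mem_zero_iff b).1 hb
      refine ⟨r * s, ?_⟩
      simp only [Algebra.linearMap_apply, Algebra.algebraMap_eq_smul_one,
        Algebra.TensorProduct.one_def, TensorProduct.smul_tmul', TensorProduct.tmul_smul, mul_smul]
      rw [smul_comm]
    exact key hz
  · rintro ⟨r, rfl⟩
    exact SetLike.algebraMap_mem_graded _ r

/-- The tensor product of two degree-reversing injections is injective and reverses total degree, so
no dimension formula for the graded pieces is needed. -/
theorem finrank_tensorGrading_le_finrank_sub [Module.Finite F A] [Module.Finite F B] {c d k : ℕ}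
    (hc : IsMaximalSocleDegree 𝒜 c) (hd : IsMaximalSocleDegree ℬ d)
    (hA : ∀ i ≤ c, Module.finrank F (𝒜 i) = Module.finrank F (𝒜 (c - i)))
    (hB : ∀ i ≤ d, Module.finrank F (ℬ i) = Module.finrank F (ℬ (d - i))) :
    Module.finrank F (tensorGrading 𝒜 ℬ k) ≤
      Module.finrank F (tensorGrading 𝒜 ℬ (c + d - k)) := by
  obtain ⟨σ, hσ, hσc⟩ := exists_injective_degree_reversing hc hA
  obtain ⟨τ, hτ, hτd⟩ := exists_injective_degree_reversing hd hB
  have hinj : Function.Injective (TensorProduct.map σ τ) :=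
    TensorProduct.map_injective_of_flat_flat σ τ hσ hτ
  have hmap : tensorGrading 𝒜 ℬ k ≤
      (tensorGrading 𝒜 ℬ (c + d - k)).comap (TensorProduct.map σ τ) := by
    refine tensorGrading_induction 𝒜 ℬ _ fun i j hij a ha b hb => ?_
    by_cases hi : c < i
    · rw [eq_zero_of_isMaximalSocleDegree_lt hc hi ha, TensorProduct.zero_tmul]
      exact zero_mem _
    by_cases hj : d < j
    · rw [eq_zero_of_isMaximalSocleDegree_lt hd hj hb, TensorProduct.tmul_zero]
      exact zero_mem _
    have := tmul_mem_tensorGrading 𝒜 ℬ (hσc i (by omega) a ha) (hτd j (by omega) b hb)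
    rwa [show c - i + (d - j) = c + d - k by omega] at this
  exact LinearMap.finrank_le_finrank_of_injective
    (f := (TensorProduct.map σ τ).restrict hmap)
    fun x y hxy => Subtype.ext (hinj (congrArg Subtype.val hxy))

/-- Products of Lefschetz strings in complementary degree lie in the image of the power of
`L ⊗ 1 + 1 ⊗ L'`. -/
theorem tmul_mem_map_mulLeft_of_mem_lefschetzStrings [CharZero F] {L : A} {L' : B} {c d k u v : ℕ}
    (hL : L ∈ 𝒜 1) (hL' : L' ∈ ℬ 1) (hk : 2 * k ≤ c + d) (huv : u + v = c + d - k)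
    {a : A} (ha : a ∈ lefschetzStrings 𝒜 L c u) {b : B} (hb : b ∈ lefschetzStrings ℬ L' d v) :
    a ⊗ₜ[F] b ∈ (tensorGrading 𝒜 ℬ k).map
      (LinearMap.mulLeft F ((L ⊗ₜ[F] (1 : B) + (1 : A) ⊗ₜ[F] L') ^ (c + d - 2 * k))) := by
  obtain ⟨i, s, p, hi, rfl, hp, hp0, rfl⟩ := ha
  obtain ⟨j, t, q, hj, rfl, hq, hq0, rfl⟩ := hb
  by_cases hs : c - 2 * i < s
  · rw [show s = (s - (c - 2 * i + 1)) + (c - 2 * i + 1) by omega, pow_add, mul_assoc, hp0,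
      mul_zero, TensorProduct.zero_tmul]
    exact zero_mem _
  by_cases ht : d - 2 * j < t
  · rw [show t = (t - (d - 2 * j + 1)) + (d - 2 * j + 1) by omega, pow_add, mul_assoc, hq0,
      mul_zero, TensorProduct.tmul_zero]
    exact zero_mem _
  -- The bounds on `s` and `t` force `i + j ≤ k`, so `r = k - i - j` is a genuine difference.
  have h := pow_mul_pow_mul_mem_map_monomialSpan (F := F) (L ⊗ₜ[F] (1 : B)) ((1 : A) ⊗ₜ[F] L')
    (p ⊗ₜ[F] q) (m := c - 2 * i) (n := d - 2 * j) (r := k - i - j) (s := s) (t := t)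
    (by simp [Algebra.TensorProduct.tmul_pow, hp0]) (by simp [Algebra.TensorProduct.tmul_pow, hq0])
    (by omega) (by omega)
  rw [show c - 2 * i + (d - 2 * j) - 2 * (k - i - j) = c + d - 2 * k by omega] at h
  have e : (L ⊗ₜ[F] (1 : B)) ^ s * ((1 : A) ⊗ₜ[F] L') ^ t * p ⊗ₜ[F] q =
      (L ^ s * p) ⊗ₜ[F] (L' ^ t * q) := by
    simp [Algebra.TensorProduct.tmul_pow]
  rw [e] at h
  refine Submodule.map_mono (Submodule.span_le.2 ?_) h
  rintro _ ⟨i', j', hij, rfl⟩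
  have := tmul_mem_tensorGrading 𝒜 ℬ (pow_mul_mem_graded hL i' hp rfl)
    (pow_mul_mem_graded hL' j' hq rfl)
  rw [show i + i' + (j + j') = k by omega] at this
  simpa [Algebra.TensorProduct.tmul_pow] using this

theorem isNarrowStrongLefschetzElement_tensorGrading [CharZero F]
    [Module.Finite F A] [Module.Finite F B] {L : A} {L' : B}
    (h : IsNarrowStrongLefschetzElement 𝒜 L) (h' : IsNarrowStrongLefschetzElement ℬ L') :
    IsNarrowStrongLefschetzElement (tensorGrading 𝒜 ℬ)
      (L ⊗ₜ[F] (1 : B) + (1 : A) ⊗ₜ[F] L') := by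
  obtain ⟨hL, c, hc, hbij⟩ := h
  obtain ⟨hL', d, hd, hbij'⟩ := h'
  have hM : L ⊗ₜ[F] (1 : B) + (1 : A) ⊗ₜ[F] L' ∈ tensorGrading 𝒜 ℬ 1 := by
    have h1 := tmul_mem_tensorGrading 𝒜 ℬ hL (SetLike.one_mem_graded ℬ)
    have h2 := tmul_mem_tensorGrading 𝒜 ℬ (SetLike.one_mem_graded 𝒜) hL'
    rw [add_zero] at h1
    rw [zero_add] at h2
    exact add_mem h1 h2
  refine ⟨hM, c + d, isMaximalSocleDegree_tensorGrading hc hd, fun k hk => ?_⟩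
  set M := L ⊗ₜ[F] (1 : B) + (1 : A) ⊗ₜ[F] L'
  have hmaps : ∀ x ∈ tensorGrading 𝒜 ℬ k,
      M ^ (c + d - 2 * k) * x ∈ tensorGrading 𝒜 ℬ (c + d - k) := fun x hx =>
    pow_mul_mem_graded hM _ hx (by omega)
  have hsurj : tensorGrading 𝒜 ℬ (c + d - k) ≤
      (tensorGrading 𝒜 ℬ k).map (LinearMap.mulLeft F (M ^ (c + d - 2 * k))) := by
    refine tensorGrading_induction 𝒜 ℬ _ fun u v huv a ha b hb => ?_
    -- By bilinearity, `a` and `b` may be taken to be single string elements.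
    have hmem := Submodule.apply_mem_map₂ (TensorProduct.mk F A B)
      (le_span_lefschetzStrings hL hc hbij u ha) (le_span_lefschetzStrings hL' hd hbij' v hb)
    rw [Submodule.map₂_span_span] at hmem
    refine Submodule.span_le.2 ?_ hmem
    rintro _ ⟨a, ha, b, hb, rfl⟩
    exact tmul_mem_map_mulLeft_of_mem_lefschetzStrings hL hL' hk huv ha hb
  exact bijOn_of_le_map_of_finrank_le (LinearMap.mulLeft F (M ^ (c + d - 2 * k))) hmaps hsurj
    (finrank_tensorGrading_le_finrank_sub hc hd (fun i hi => finrank_eq_finrank_sub hbij hi)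
      fun i hi => finrank_eq_finrank_sub hbij' hi)

end Tensor

theorem mainTheorem2 {F A A' : Type*} [Field F] [CharZero F]
    [CommRing A] [Algebra F A] [CommRing A'] [Algebra F A']
    (𝒜 : ℕ → Submodule F A) [GradedAlgebra 𝒜]
    (𝒜' : ℕ → Submodule F A') [GradedAlgebra 𝒜']
    (hA : IsGradedArtinianAlgebra 𝒜) (hA' : IsGradedArtinianAlgebra 𝒜') :
    IsGradedArtinianAlgebra (tensorGrading 𝒜 𝒜') ∧
    (IsAlgClosed F → ∀ (L : A) (L' : A'),
      IsNarrowStrongLefschetzElement 𝒜 L → IsNarrowStrongLefschetzElement 𝒜' L' →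
        IsNarrowStrongLefschetzElement (tensorGrading 𝒜 𝒜')
          (L ⊗ₜ[F] (1 : A') + (1 : A) ⊗ₜ[F] L')) ∧
    (HasNarrowStrongLefschetzProperty 𝒜 → HasNarrowStrongLefschetzProperty 𝒜' →
      HasNarrowStrongLefschetzProperty (tensorGrading 𝒜 𝒜')) := by
  have := hA.finite
  have := hA'.finite
  exact ⟨isGradedArtinianAlgebra_tensorGrading hA hA',
    fun _ _ _ => isNarrowStrongLefschetzElement_tensorGrading,
    fun ⟨_, h⟩ ⟨_, h'⟩ => ⟨_, isNarrowStrongLefschetzElement_tensorGrading h h'⟩⟩
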